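/- Setting. Let $\mathcal A$ be a finite nonempty set of candidates and let $f$ be a centered Gaussian process on $\mathcal A$ with covariance function $\mathrm k$, where $\mathrm k(x,x)\le\kappa^2$ for all $x\in\mathcal A$. Evaluating a candidate $x_t$ at step $t$ returns the feedback $y_t=f(x_t)+\eta_t$, where $\eta_1,\eta_2,\dots$ are i.i.d. $\mathcal N(0,\xi^2)$ with $\xi>0$, independent of $f$. Put $\lambda=\xi^2$. With $X_t=(x_1,\dots,x_t)$, $\mathbf y_t=(y_1,\dots,y_t)^{\mathsf T}$ and $K_t=\mathrm k(X_t,X_t)$, the posterior mean and variance are $$\mu_t(x)=\mathrm k(x,X_t)(K_t+\lambda I)^{-1}\mathbf y_t,\qquad \sigma_t^2(x)=\mathrm k(x,x)-\mathrm k(x,X_t)(K_t+\lambda I)^{-1}\mathrm k(X_t,x).$$ The maximum information gain is $\gamma_T=\max_{X\in\mathcal A^T}\tfrac12\log\det\bigl(I+\xi^{-2}\mathrm k(X,X)\bigr)$, and the cumulative regret is $R_T=\sum_{t=1}^T\bigl(\max_{x\in\mathcal A}f(x)-f(x_t)\bigr)$. Mini-GP-UCB with threshold $C>1$ proceeds in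 epochs. If an epoch begins after $t$ completed steps, the algorithm selects $$x_{t+1}\in\arg\max_{x\in\mathcal A}\ \mu_t(x)+\beta_{t+1}\sigma_t(x),\qquad \beta_t=\sqrt{2\log\bigl(|\mathcal A|\,t^2\pi^2/(6\delta)\bigr)},$$ where ties are broken by any measurable rule that depends only on the feedback observed so far. It evaluates this candidate $B=\max\bigl\{1,\lfloor (C^2-1)/\sigma_t^2(x_{t+1})\rfloor\bigr\}$ times (forever if $\sigma_t(x_{t+1})=0$), and then begins the next epoch. Theorem. There is an absolute constant $p\in\mathbb N$ and, for all $\kappa$ and $\xi>0$, a constant $K>0$ depending only on $\kappa$ and $\xi$, such that in this setting, for every $C>1$ and every $\delta\in(0,1]$, the candidates selected by mini-GP-UCB satisfy, with probability at least $1-\delta$, $$R_T\ \le\ K\,\Bigl(1+\log\tfrac{|\mathcal A|\,T}{\delta}\Bigr)^{p}\;C\sqrt{T\gamma_T}\qquad\text{for all }T\ge1 ;$$ that is, $R_T\le\widetilde{\mathcal O}\bigl(C\sqrt{T\gamma_T}\bigr)$, where $\widetilde{\mathcal O}$ hides factors that are polylogarithmic in $|\mathcal A|$, $T$ and $1/\delta$,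 and constants that depend on $\kappa$ and $\xi$. -/

import Mathlib

open MeasureTheory ProbabilityTheory

noncomputable section

namespace MiniGP

variable {A : Type*}

/-- The kernel matrix `k(X, X)` of a finite sequence `X` of candidates (repetitions allowed). -/
def kernelMatrix (k : A → A → ℝ) {t : ℕ} (X : Fin t → A) : Matrix (Fin t) (Fin t) ℝ :=
  Matrix.of fun i j => k (X i) (X j)

/-- Posterior mean `k(a, X) (k(X, X) + lam I)⁻¹ y` at the point `a`, given the feedback `y`
observed at the candidates `X`. -/
def postMean (k : A → A → ℝ) (lam : ℝ) {t : ℕ} (X : Fin t → A) (y : Fin t → ℝ) (a : A) : ℝ :=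
  (fun i => k a (X i)) ⬝ᵥ
    (Matrix.mulVec (kernelMatrix k X + lam • (1 : Matrix (Fin t) (Fin t) ℝ))⁻¹ y)

/-- Posterior variance `k(a, a) - k(a, X) (k(X, X) + lam I)⁻¹ k(X, a)` at the point `a`. -/
def postVar (k : A → A → ℝ) (lam : ℝ) {t : ℕ} (X : Fin t → A) (a : A) : ℝ :=
  k a a - (fun i => k a (X i)) ⬝ᵥ
    (Matrix.mulVec (kernelMatrix k X + lam • (1 : Matrix (Fin t) (Fin t) ℝ))⁻¹
      (fun i => k (X i) a))

/-- The GP-UCB acquisition function with exploration coefficient `b`: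
posterior mean plus `b` times the posterior standard deviation. -/
def ucb (k : A → A → ℝ) (lam b : ℝ) {t : ℕ} (X : Fin t → A) (y : Fin t → ℝ) (a : A) : ℝ :=
  postMean k lam X y a + b * Real.sqrt (postVar k lam X a)

/-- Length of an epoch whose candidate has posterior variance `v` at the start of the epoch:
`⌊(C² - 1) / v⌋`, but at least one evaluation, and infinite (the epoch never ends) if `v = 0`. -/
def batchLength (C v : ℝ) : ℕ∞ :=
  open Classical in if v = 0 then ⊤ else ((max 1 ⌊(C ^ 2 - 1) / v⌋₊ : ℕ) : ℕ∞)

/-- `x t` is the candidate evaluated at step `t + 1`. `epochStart k lam C x t` is the number of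
steps completed before the beginning of the epoch that contains step `t + 1`. A new epoch begins
as soon as the current one has reached its length, which is fixed at its beginning. -/
def epochStart (k : A → A → ℝ) (lam C : ℝ) (x : ℕ → A) : ℕ → ℕ
  | 0 => 0
  | t + 1 =>
    let s := epochStart k lam C x t
    open Classical in
    if ((t + 1 : ℕ) : ℕ∞) < (s : ℕ∞) + batchLength C (postVar k lam (fun i : Fin s => x i) (x s))
    then s else t + 1

/-- The candidates `x` and the feedback `y` (`x t` and `y t` belong to step `t + 1`) form a run of
mini-GP-UCB with regularization `lam`, threshold `C` and exploration coefficients `β`: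
at the first step `t + 1` of each epoch the candidate maximizes the acquisition function
`μ_t + β_{t+1} σ_t` built from the data of the first `t` steps, and this candidate is repeated
until the end of the epoch. -/
structure IsRun (k : A → A → ℝ) (lam C : ℝ) (β : ℕ → ℝ) (x : ℕ → A) (y : ℕ → ℝ) : Prop where
  select : ∀ t, epochStart k lam C x t = t → ∀ a,
    ucb k lam (β (t + 1)) (fun i : Fin t => x i) (fun i : Fin t => y i) a ≤
      ucb k lam (β (t + 1)) (fun i : Fin t => x i) (fun i : Fin t => y i) (x t)
  repeated : ∀ t, x t = x (epochStart k lam C x t)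

/-- A (measurable) decision rule `sel`, which maps the feedback of the first `t` steps to the
candidate of step `t + 1`, implements mini-GP-UCB if it produces a run of mini-GP-UCB for every
feedback sequence. Two such rules differ only in how they break ties between maximizers. -/
structure IsMiniGPUCB (k : A → A → ℝ) (lam C : ℝ) (β : ℕ → ℝ)
    (sel : (t : ℕ) → (Fin t → ℝ) → A) : Prop where
  measurable : ∀ t a, MeasurableSet (sel t ⁻¹' {a})
  isRun : ∀ y : ℕ → ℝ, IsRun k lam C β (fun t => sel t (fun i => y i)) y

/-- `β_t = √(2 log(n t² π² / (6 δ)))`, where `n` is the number of candidates. -/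
def betaBayes (n : ℕ) (δ : ℝ) (t : ℕ) : ℝ :=
  Real.sqrt (2 * Real.log (n * (t : ℝ) ^ 2 * Real.pi ^ 2 / (6 * δ)))

/-- Information gain `½ log det(I + ξ⁻² k(X, X))`. -/
def infoGain (k : A → A → ℝ) (ξ : ℝ) {t : ℕ} (X : Fin t → A) : ℝ :=
  1 / 2 * Real.log (1 + (ξ ^ 2)⁻¹ • kernelMatrix k X).det

/-- Maximum information gain `γ_t`: the maximum of the information gain over all sequences of `t`
candidates, repetitions allowed (there are finitely many if `A` is finite). -/
def maxInfoGain (k : A → A → ℝ) (ξ : ℝ) (t : ℕ) : ℝ :=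
  ⨆ X : Fin t → A, infoGain k ξ X

/-- Cumulative regret `R_T = ∑_{t = 1}^T (f⋆ - f(x_t))`, with `f⋆ = max f`. -/
def regret (f : A → ℝ) (x : ℕ → A) (T : ℕ) : ℝ :=
  ∑ t ∈ Finset.range T, ((⨆ a, f a) - f (x t))

variable {Ω : Type*} [MeasurableSpace Ω]

/-- `f` is a Gaussian process on `A` with mean zero and covariance function `k`. -/
structure IsCenteredGP (k : A → A → ℝ) (f : A → Ω → ℝ) (P : Measure Ω) : Prop where
  gaussian : IsGaussianProcess f P
  mean_zero : ∀ a, ∫ ω, f a ω ∂P = 0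
  cov_eq : ∀ a b, cov[f a, f b; P] = k a b

/-- `η` is a sequence of i.i.d. `N(0, ξ²)` variables, independent of the random function `f`. -/
structure IsGaussianNoise (ξ : ℝ) (f : A → Ω → ℝ) (η : ℕ → Ω → ℝ) (P : Measure Ω) : Prop where
  law : ∀ t, HasLaw (η t) (gaussianReal 0 (Real.toNNReal (ξ ^ 2))) P
  iIndep : iIndepFun η P
  indep : IndepFun (fun ω a => f a ω) (fun ω t => η t ω) P

end MiniGP

end

noncomputable section

namespace MiniGP

open Matrix

variable {A : Type*}

/-! The regret of a step is governed by the confidence width at the start of its epoch, and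
repeating a candidate makes that width stale by only a bounded factor. If all confidence bounds
hold, the optimistic choice at the start s of an epoch costs at most 2 β_{s+1} σ_s(x_t) at each step
of the epoch. Observing one candidate b times adds at most b/λ to its precision 1/σ², so σ_s² ≤ (1 +
b σ_s²/λ) σ_{s+b}². The epoch length keeps b σ_s² ≤ C² - 1, hence σ_s is at most C √(1 + 1/λ) times
the current width (`postVar_epochStart_le`). The widths now use all data, as in plain GP-UCB:
Cauchy–Schwarz and the chain rule for the information gain (`infoGain_succ`, `sum_postVar_le`) bound
their sum by a multiple of √(T γ_T), and `regret_le` assembles the estimate.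

The confidence bounds must hold although the candidates depend on the feedback. For a fixed sequence
X the prediction error is a centered Gaussian with the posterior variance, uncorrelated with the
feedback and hence independent of it (`indepFun_feedback_postError`). That the algorithm selects X
is an event in this feedback, so the Gaussian tail bound survives on it, and these events are
disjoint (`measure_confidence_fail_le`). A union bound over candidates and steps gives
`le_measure_confidence`. -/

/-- The regularized kernel matrix `k(X, X) + lam I`. -/
abbrev regMatrix (k : A → A → ℝ) (lam : ℝ) {t : ℕ} (X : Fin t → A) : Matrix (Fin t) (Fin t) ℝ :=
  kernelMatrix k X + lam • (1 : Matrix (Fin t) (Fin t) ℝ)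

/-- The weights `(k(X, X) + lam I)⁻¹ k(X, a)` of the observations in the posterior mean at `a`. -/
def postWeights (k : A → A → ℝ) (lam : ℝ) {t : ℕ} (X : Fin t → A) (a : A) : Fin t → ℝ :=
  (regMatrix k lam X)⁻¹ *ᵥ fun i => k (X i) a

/-! ### Posterior variance and information gain along a fixed sequence of candidates. -/

section Deterministic

variable {k : A → A → ℝ} {lam : ℝ}

lemma regMatrix_posDef (hpsd : ∀ (t : ℕ) (X : Fin t → A), (kernelMatrix k X).PosSemidef)
    (hlam : 0 < lam) {t : ℕ} (X : Fin t → A) : (regMatrix k lam X).PosDef :=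
  Matrix.PosDef.posSemidef_add (hpsd t X) (Matrix.PosDef.one.smul hlam)

lemma regMatrix_mulVec_postWeights
    (hpsd : ∀ (t : ℕ) (X : Fin t → A), (kernelMatrix k X).PosSemidef)
    (hlam : 0 < lam) {t : ℕ} (X : Fin t → A) (a : A) :
    regMatrix k lam X *ᵥ postWeights k lam X a = fun i => k (X i) a := by
  rw [postWeights, Matrix.mulVec_mulVec, Matrix.mul_nonsing_inv, Matrix.one_mulVec]
  exact (Matrix.isUnit_iff_isUnit_det _).1 (regMatrix_posDef hpsd hlam X).isUnit

lemma postVar_eq_sub (t : ℕ) (X : Fin t → A) (a : A) :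
    postVar k lam X a = k a a - ∑ i, k a (X i) * postWeights k lam X a i := rfl

lemma regMatrix_transpose (hsymm : ∀ a b, k a b = k b a) {t : ℕ} (X : Fin t → A) :
    (regMatrix k lam X)ᵀ = regMatrix k lam X := by
  ext i j
  simp [regMatrix, kernelMatrix, hsymm (X j) (X i), Matrix.one_apply, eq_comm]

/-- Symmetry moves the inverse matrix onto the kernel vector. Once the candidates are fixed, the
prediction error is thus a fixed linear functional of `f` and the noise. -/
lemma postMean_eq_sum (hsymm : ∀ a b, k a b = k b a) {t : ℕ} (X : Fin t → A) (y : Fin t → ℝ)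
    (a : A) : postMean k lam X y a = ∑ i, postWeights k lam X a i * y i := by
  have h : (fun i => k a (X i)) = fun i => k (X i) a := funext fun i => hsymm _ _
  rw [postMean, Matrix.dotProduct_mulVec, postWeights, h, ← Matrix.mulVec_transpose,
    Matrix.transpose_nonsing_inv, regMatrix_transpose hsymm]
  rfl

/-- The posterior variance minimizes the mean squared error of linear predictors. -/
lemma sq_mul_postVar_le (hsymm : ∀ a b, k a b = k b a)
    (hpsd : ∀ (t : ℕ) (X : Fin t → A), (kernelMatrix k X).PosSemidef)
    (hlam : 0 < lam) {t : ℕ} (X : Fin t → A) (a : A) (u : ℝ) (w : Fin t → ℝ) :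
    u ^ 2 * postVar k lam X a ≤
      u ^ 2 * k a a - 2 * u * (w ⬝ᵥ fun i => k (X i) a) + w ⬝ᵥ (regMatrix k lam X *ᵥ w) := by
  -- Completing the square: the right side minus the left side is this quadratic form.
  have h := (regMatrix_posDef hpsd hlam X).posSemidef.dotProduct_mulVec_nonneg
    (w - u • postWeights k lam X a)
  have hz := regMatrix_mulVec_postWeights hpsd hlam X a
  have hv : postVar k lam X a = k a a - postWeights k lam X a ⬝ᵥ fun i => k (X i) a := by
    rw [postVar_eq_sub, dotProduct]
    simp only [hsymm a, mul_comm]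
  have hc : postWeights k lam X a ⬝ᵥ (regMatrix k lam X *ᵥ w) = w ⬝ᵥ fun i => k (X i) a := by
    rw [Matrix.dotProduct_mulVec, ← Matrix.mulVec_transpose, regMatrix_transpose hsymm, hz,
      dotProduct_comm]
  simp only [star_trivial, Matrix.mulVec_sub, Matrix.mulVec_smul, hz, dotProduct_sub,
    sub_dotProduct, smul_dotProduct, dotProduct_smul, smul_eq_mul, hc] at h
  rw [hv]
  linarith

lemma postVar_eq_quadratic (hsymm : ∀ a b, k a b = k b a)
    (hpsd : ∀ (t : ℕ) (X : Fin t → A), (kernelMatrix k X).PosSemidef)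
    (hlam : 0 < lam) {t : ℕ} (X : Fin t → A) (a : A) :
    postVar k lam X a = k a a - 2 * (postWeights k lam X a ⬝ᵥ fun i => k (X i) a) +
      postWeights k lam X a ⬝ᵥ (regMatrix k lam X *ᵥ postWeights k lam X a) := by
  rw [regMatrix_mulVec_postWeights hpsd hlam, postVar_eq_sub, dotProduct]
  simp only [hsymm a, mul_comm (k _ a)]
  ring

/-- With the optimal weights w, the posterior variance is the prior quadratic form of (1, -w) on the
points (a, X) plus λ|w|², and both terms are nonnegative. -/
lemma postVar_nonneg (hsymm : ∀ a b, k a b = k b a)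
    (hpsd : ∀ (t : ℕ) (X : Fin t → A), (kernelMatrix k X).PosSemidef)
    (hlam : 0 < lam) {t : ℕ} (X : Fin t → A) (a : A) : 0 ≤ postVar k lam X a := by
  rw [postVar_eq_quadratic hsymm hpsd hlam]
  set w := postWeights k lam X a
  have h := (hpsd (t + 1) (Fin.cons a X)).dotProduct_mulVec_nonneg
    (Fin.cons 1 (-w) : Fin (t + 1) → ℝ)
  have h' : 0 ≤ w ⬝ᵥ w := Finset.sum_nonneg fun i _ => mul_self_nonneg _
  simp only [dotProduct, Matrix.mulVec, kernelMatrix, Matrix.of_apply, Fin.sum_univ_succ,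
    Fin.cons_zero, Fin.cons_succ, star_trivial, Pi.neg_apply, hsymm a (X _)] at h
  simp only [regMatrix, Matrix.add_mulVec, Matrix.smul_mulVec, Matrix.one_mulVec, dotProduct_add,
    dotProduct_smul, smul_eq_mul]
  have h2 := mul_nonneg hlam.le h'
  simp only [dotProduct, Matrix.mulVec, kernelMatrix, Matrix.of_apply] at h2 ⊢
  simp only [mul_add, neg_mul, mul_neg, Finset.sum_add_distrib, Finset.sum_neg_distrib, one_mul,
    neg_neg, mul_comm (k _ a)] at h
  linarith

/-- The posterior variance is at most the prior variance. -/
lemma postVar_le_prior (hsymm : ∀ a b, k a b = k b a)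
    (hpsd : ∀ (t : ℕ) (X : Fin t → A), (kernelMatrix k X).PosSemidef)
    (hlam : 0 < lam) {t : ℕ} (X : Fin t → A) (a : A) : postVar k lam X a ≤ k a a := by
  simpa using sq_mul_postVar_le hsymm hpsd hlam X a 1 0

/-- Observing the candidate `a` once more increases the precision at `a` by at most `1 / lam`. -/
lemma mul_postVar_le_postVar_succ (hsymm : ∀ a b, k a b = k b a)
    (hpsd : ∀ (t : ℕ) (X : Fin t → A), (kernelMatrix k X).PosSemidef)
    (hlam : 0 < lam) (x : ℕ → A) (t : ℕ) :
    lam * postVar k lam (fun i : Fin t => x i) (x t) ≤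
      (lam + postVar k lam (fun i : Fin t => x i) (x t)) *
        postVar k lam (fun i : Fin (t + 1) => x i) (x t) := by
  set v := postVar k lam (fun i : Fin t => x i) (x t) with hv
  set w := postWeights k lam (fun i : Fin (t + 1) => x i) (x t) with hw
  -- The newest observation sits at the target itself: giving it weight `c` leaves the fraction `1 -
  -- c` of the target for the old data to predict.
  set c := w (Fin.last t) with hc
  have h1 := sq_mul_postVar_le hsymm hpsd hlam (fun i : Fin t => x i) (x t) (1 - c)
    (fun i => w i.castSucc)
  have h2 : postVar k lam (fun i : Fin (t + 1) => x i) (x t) =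
      (1 - c) ^ 2 * k (x t) (x t) -
        2 * (1 - c) * ((fun i : Fin t => w i.castSucc) ⬝ᵥ fun i => k (x i) (x t)) +
        (fun i : Fin t => w i.castSucc) ⬝ᵥ
          (regMatrix k lam (fun i : Fin t => x i) *ᵥ fun i => w i.castSucc) + lam * c ^ 2 := by
    rw [postVar_eq_quadratic hsymm hpsd hlam]
    have e : ∀ i : Fin t, (Fin.last t = i.castSucc) = False := fun i => by
      simpa using (Fin.castSucc_lt_last i).ne'
    simp only [regMatrix, dotProduct, Matrix.mulVec, Fin.sum_univ_castSucc, Matrix.add_apply,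
      Matrix.smul_apply, kernelMatrix, Matrix.of_apply, Matrix.one_apply, Fin.castSucc_inj,
      Fin.val_castSucc, Fin.val_last, smul_eq_mul, ← hw, ← hc, e,
      (Fin.castSucc_lt_last _).ne, if_true, if_false, hsymm (x t) (x _)]
    simp only [mul_add, Finset.sum_add_distrib, Finset.mul_sum]
    have e2 : ∑ i : Fin t, c * (k (x i) (x t) * w i.castSucc) =
        ∑ i : Fin t, w i.castSucc * (k (x i) (x t) * c) :=
      Finset.sum_congr rfl fun _ _ => by ring
    have e3 : ∑ i : Fin t, 2 * (1 - c) * (w i.castSucc * k (x i) (x t)) =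
        ∑ i : Fin t, 2 * (w i.castSucc * k (x i) (x t)) -
          2 * ∑ i : Fin t, w i.castSucc * (k (x i) (x t) * c) := by
      rw [Finset.mul_sum, ← Finset.sum_sub_distrib]
      exact Finset.sum_congr rfl fun _ _ => by ring
    simp only [add_mul, mul_add, Finset.sum_add_distrib, mul_zero, zero_mul,
      Finset.sum_const_zero] at *
    rw [e3]
    linarith
  rw [h2]
  have hv0 : 0 ≤ v := postVar_nonneg hsymm hpsd hlam _ _
  -- By `h1` the new variance is at least (1 - c)² v + λ c², and λ + v times this, minus λ v, is the
  -- square (v (1 - c) - λ c)².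
  nlinarith [mul_le_mul_of_nonneg_left h1 (add_nonneg hlam.le hv0),
    sq_nonneg (v * (1 - c) - lam * c)]

/-- If the same candidate is observed at the steps `s + 1, …, s + b`, its posterior variance
shrinks by a factor of at most `1 + b v / lam`, where `v` is its value at the beginning. -/
lemma postVar_le_mul_postVar_of_repeated (hsymm : ∀ a b, k a b = k b a)
    (hpsd : ∀ (t : ℕ) (X : Fin t → A), (kernelMatrix k X).PosSemidef)
    (hlam : 0 < lam) (x : ℕ → A) (s b : ℕ) (hx : ∀ i ≤ b, x (s + i) = x s) :
    lam * postVar k lam (fun i : Fin s => x i) (x s) ≤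
      (lam + b * postVar k lam (fun i : Fin s => x i) (x s)) *
        postVar k lam (fun i : Fin (s + b) => x i) (x s) := by
  induction b with
  | zero => simp
  | succ b ih =>
    have ih := ih fun i hi => hx i (by omega)
    have h := mul_postVar_le_postVar_succ hsymm hpsd hlam x (s + b)
    rw [hx b (by omega)] at h
    have h0 := postVar_nonneg hsymm hpsd hlam (fun i : Fin s => x i) (x s)
    have h1 := postVar_nonneg hsymm hpsd hlam (fun i : Fin (s + b) => x i) (x s)
    have h2 := postVar_nonneg hsymm hpsd hlam (fun i : Fin (s + b + 1) => x i) (x s)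
    change _ ≤ _ * postVar k lam (fun i : Fin (s + b + 1) => x i) (x s)
    set v := postVar k lam (fun i : Fin s => x i) (x s)
    set v1 := postVar k lam (fun i : Fin (s + b) => x i) (x s)
    set v2 := postVar k lam (fun i : Fin (s + b + 1) => x i) (x s)
    have hb : 0 ≤ lam + b * v := by positivity
    push_cast
    -- In terms of precisions, 1/v2 ≤ 1/v1 + 1/λ ≤ 1/v + (b + 1)/λ. Chaining the cross-multiplied
    -- forms requires λ - v2 ≥ 0; for λ ≤ v2 the term v v2 alone suffices.
    rcases le_or_gt lam v2 with hle | hlt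
    · have h3 := mul_le_mul_of_nonneg_left hle h0
      nlinarith [mul_nonneg (mul_nonneg (Nat.cast_nonneg (α := ℝ) b) h0) h2, mul_nonneg hlam.le h2]
    · have h3 := mul_le_mul_of_nonneg_right ih (sub_nonneg.2 hlt.le)
      have h4 : v1 * (lam - v2) ≤ lam * v2 := by linarith
      have h5 := mul_le_mul_of_nonneg_left h4 hb
      have h6 : lam * (v * (lam - v2)) ≤ lam * ((lam + b * v) * v2) := by linarith
      have h7 := le_of_mul_le_mul_left h6 hlam
      linarith

/-- Chain rule for the information gain. -/
lemma infoGain_succ (hsymm : ∀ a b, k a b = k b a)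
    (hpsd : ∀ (t : ℕ) (X : Fin t → A), (kernelMatrix k X).PosSemidef)
    {ξ : ℝ} (hξ : 0 < ξ) (x : ℕ → A) (t : ℕ) :
    infoGain k ξ (fun i : Fin (t + 1) => x i) = infoGain k ξ (fun i : Fin t => x i) +
      1 / 2 * Real.log (1 + postVar k (ξ ^ 2) (fun i : Fin t => x i) (x t) / ξ ^ 2) := by
  have hlam : 0 < ξ ^ 2 := by positivity
  set X : Fin t → A := fun i => x i
  set lam := ξ ^ 2
  set M := 1 + lam⁻¹ • kernelMatrix k X with hM
  have hMr : M = lam⁻¹ • regMatrix k lam X := by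
    rw [hM, regMatrix, smul_add, smul_smul, inv_mul_cancel₀ hlam.ne', one_smul, add_comm]
  have hMpos : M.PosDef := hMr ▸ (regMatrix_posDef hpsd hlam X).smul (inv_pos.2 hlam)
  have hMdet : 0 < M.det := hMpos.det_pos
  let _ := Matrix.invertibleOfIsUnitDet M hMdet.ne'.isUnit
  let B : Matrix (Fin t) (Fin 1) ℝ := Matrix.of fun i _ => lam⁻¹ * k (X i) (x t)
  let D : Matrix (Fin 1) (Fin 1) ℝ := Matrix.of fun _ _ => 1 + lam⁻¹ * k (x t) (x t)
  -- Splitting off the last point leaves a 1×1 Schur complement, which equals one plus the posterior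
  -- variance divided by λ.
  have hblock : (1 + lam⁻¹ • kernelMatrix k (fun i : Fin (t + 1) => x i)).submatrix
      finSumFinEquiv finSumFinEquiv = Matrix.fromBlocks M B Bᵀ D := by
    ext i j
    rcases i with i | i <;> rcases j with j | j
    · simp [hM, kernelMatrix, X, Matrix.one_apply, Fin.ext_iff]
    · have hj : j = 0 := Subsingleton.elim _ _
      simp [kernelMatrix, X, B, hj, Fin.ext_iff, i.isLt.ne]
    · have hi : i = 0 := Subsingleton.elim _ _
      simp [kernelMatrix, X, B, hi, Fin.ext_iff, j.isLt.ne',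
        hsymm (x t) (x j)]
    · have hi : i = 0 := Subsingleton.elim _ _
      have hj : j = 0 := Subsingleton.elim _ _
      simp [kernelMatrix, D, hi, hj]
  have hdet : (1 + lam⁻¹ • kernelMatrix k (fun i : Fin (t + 1) => x i)).det =
      M.det * (1 + postVar k lam X (x t) / lam) := by
    rw [← Matrix.det_submatrix_equiv_self finSumFinEquiv, hblock, Matrix.det_fromBlocks₁₁,
      Matrix.det_fin_one, Matrix.invOf_eq_nonsing_inv]
    congr 1
    have hinv : M⁻¹ = lam • (regMatrix k lam X)⁻¹ := by
      refine Matrix.inv_eq_right_inv ?_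
      rw [hMr, Matrix.smul_mul, Matrix.mul_smul, smul_smul, inv_mul_cancel₀ hlam.ne', one_smul,
        Matrix.mul_nonsing_inv]
      exact (Matrix.isUnit_iff_isUnit_det _).1 (regMatrix_posDef hpsd hlam X).isUnit
    have hB : (Bᵀ * M⁻¹ * B) 0 0 = lam⁻¹ * ∑ i, k (x t) (X i) * postWeights k lam X (x t) i := by
      rw [hinv, Matrix.mul_assoc]
      simp only [Matrix.mul_apply, Matrix.transpose_apply, B, Matrix.of_apply, Matrix.smul_apply,
        postWeights, Matrix.mulVec, dotProduct, smul_eq_mul, Finset.mul_sum]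
      refine Finset.sum_congr rfl fun i _ => Finset.sum_congr rfl fun j _ => ?_
      rw [hsymm (x t)]
      field_simp
    rw [Matrix.sub_apply, hB, postVar_eq_sub]
    simp only [D, Matrix.of_apply]
    ring
  have hv := postVar_nonneg hsymm hpsd hlam X (x t)
  rw [infoGain, infoGain, hdet, Real.log_mul hMdet.ne' (by positivity)]
  ring

lemma infoGain_eq_sum (hsymm : ∀ a b, k a b = k b a)
    (hpsd : ∀ (t : ℕ) (X : Fin t → A), (kernelMatrix k X).PosSemidef)
    {ξ : ℝ} (hξ : 0 < ξ) (x : ℕ → A) (T : ℕ) :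
    infoGain k ξ (fun i : Fin T => x i) = ∑ t ∈ Finset.range T,
      1 / 2 * Real.log (1 + postVar k (ξ ^ 2) (fun i : Fin t => x i) (x t) / ξ ^ 2) := by
  induction T with
  | zero => simp [infoGain]
  | succ T ih => rw [Finset.sum_range_succ, ← ih, infoGain_succ hsymm hpsd hξ]

lemma le_mul_log_one_add {z m : ℝ} (hz : 0 ≤ z) (hm : z ≤ m) : z ≤ (1 + m) * Real.log (1 + z) := by
  have h := Real.one_sub_inv_le_log_of_pos (show 0 < 1 + z by positivity)
  have h2 : z = (1 + z) * (1 - (1 + z)⁻¹) := by field_simp; ring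
  have h3 : 0 ≤ Real.log (1 + z) := Real.log_nonneg (by linarith)
  nlinarith [mul_le_mul_of_nonneg_left h (show 0 ≤ 1 + z by positivity)]

/-- Each term of the chain rule is a logarithm comparable to its argument, because the variances
never exceed κ²; the constant is the price of this comparison. -/
lemma sum_postVar_le (hsymm : ∀ a b, k a b = k b a)
    (hpsd : ∀ (t : ℕ) (X : Fin t → A), (kernelMatrix k X).PosSemidef)
    [Finite A] {κ ξ : ℝ} (hk : ∀ a, k a a ≤ κ ^ 2) (hξ : 0 < ξ) (x : ℕ → A) (T : ℕ) :
    ∑ t ∈ Finset.range T, postVar k (ξ ^ 2) (fun i : Fin t => x i) (x t) ≤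
      2 * (ξ ^ 2 + κ ^ 2) * maxInfoGain k ξ T := by
  have hlam : 0 < ξ ^ 2 := by positivity
  have h1 : infoGain k ξ (fun i : Fin T => x i) ≤ maxInfoGain k ξ T :=
    le_ciSup (f := fun X : Fin T → A => infoGain k ξ X) (Set.finite_range _).bddAbove _
  refine le_trans ?_ (mul_le_mul_of_nonneg_left h1 (by positivity))
  rw [infoGain_eq_sum hsymm hpsd hξ, Finset.mul_sum]
  refine Finset.sum_le_sum fun t _ => ?_
  set v := postVar k (ξ ^ 2) (fun i : Fin t => x i) (x t)
  have hv : 0 ≤ v := postVar_nonneg hsymm hpsd hlam _ _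
  have hvk : v ≤ κ ^ 2 := (postVar_le_prior hsymm hpsd hlam _ _).trans (hk _)
  have h := le_mul_log_one_add (div_nonneg hv hlam.le)
    (div_le_div_of_nonneg_right hvk hlam.le)
  have h' := mul_le_mul_of_nonneg_left h hlam.le
  have e1 : ξ ^ 2 * (v / ξ ^ 2) = v := by field_simp
  have e2 : ξ ^ 2 * (1 + κ ^ 2 / ξ ^ 2) = ξ ^ 2 + κ ^ 2 := by field_simp
  rw [e1, ← mul_assoc, e2] at h'
  linarith

end Deterministic

/-! ### Epochs and the staleness of the posterior variance. -/

section Epochs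

variable {k : A → A → ℝ} {lam C : ℝ} {x : ℕ → A}

lemma one_le_batchLength (C v : ℝ) : 1 ≤ batchLength C v := by
  unfold batchLength
  split_ifs
  · exact le_top
  · exact_mod_cast le_max_left _ _

/-- The strict inequality makes the minimum length 1 harmless: it only admits `b = 0`. An infinite
epoch has `v = 0`. -/
lemma mul_le_of_lt_batchLength {v : ℝ} (hC : 1 ≤ C) (hv : 0 ≤ v) {b : ℕ}
    (hb : (b : ℕ∞) < batchLength C v) : b * v ≤ C ^ 2 - 1 := by
  have hC' : 0 ≤ C ^ 2 - 1 := by nlinarith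
  rcases hv.eq_or_lt with rfl | hv
  · simpa using hC'
  rw [batchLength, if_neg hv.ne', Nat.cast_lt, lt_max_iff] at hb
  rcases hb with hb | hb
  · obtain rfl : b = 0 := by omega
    simpa using hC'
  · rw [← le_div_iff₀ hv]
    exact (Nat.cast_le.2 hb.le).trans (Nat.floor_le (div_nonneg hC' hv.le))

lemma epochStart_le (t : ℕ) : epochStart k lam C x t ≤ t := by
  induction t with
  | zero => simp [epochStart]
  | succ t ih =>
    rw [epochStart]
    split_ifs
    · omega
    · exact le_rfl

/-- The start either persists or jumps to the current step. This serves twice: the start of an epoch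
is its own start, so the selection rule applies there, and all steps since then repeat one
candidate. -/
lemma epochStart_eq_of_mem (t : ℕ) : ∀ i, epochStart k lam C x t ≤ i → i ≤ t →
    epochStart k lam C x i = epochStart k lam C x t := by
  induction t with
  | zero =>
    intro i _ hi
    rw [Nat.le_zero.1 hi]
  | succ t ih =>
    intro i h1 h2
    rcases h2.eq_or_lt with rfl | h2
    · rfl
    have he : epochStart k lam C x (t + 1) = epochStart k lam C x t := by
      rw [epochStart] at h1 ⊢
      split_ifs at h1 ⊢
      · rfl
      · omega
    rw [he] at h1 ⊢
    exact ih i h1 (by omega)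

lemma lt_epochStart_add_batchLength (t : ℕ) :
    (t : ℕ∞) < (epochStart k lam C x t : ℕ∞) + batchLength C
      (postVar k lam (fun i : Fin (epochStart k lam C x t) => x i) (x (epochStart k lam C x t))) := by
  have key : ∀ t : ℕ, ((t : ℕ) : ℕ∞) <
      (t : ℕ∞) + batchLength C (postVar k lam (fun i : Fin t => x i) (x t)) := fun t =>
    lt_of_lt_of_le (by exact_mod_cast Nat.lt_succ_self t)
      (add_le_add_right (one_le_batchLength _ _) _)
  cases t with
  | zero => exact key 0
  | succ t =>
    by_cases h : ((t + 1 : ℕ) : ℕ∞) < (epochStart k lam C x t : ℕ∞) + batchLength C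
      (postVar k lam (fun i : Fin (epochStart k lam C x t) => x i) (x (epochStart k lam C x t)))
    · have he : epochStart k lam C x (t + 1) = epochStart k lam C x t := by
        rw [epochStart]
        exact if_pos h
      rw [he]
      exact h
    · have he : epochStart k lam C x (t + 1) = t + 1 := by
        rw [epochStart]
        exact if_neg h
      rw [he]
      exact key (t + 1)

/-- Within an epoch, the posterior variance of the repeated candidate decreases by a factor of at
most `C² (1 + 1 / lam)`. -/
lemma postVar_epochStart_le (hsymm : ∀ a b, k a b = k b a)
    (hpsd : ∀ (t : ℕ) (X : Fin t → A), (kernelMatrix k X).PosSemidef)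
    (hlam : 0 < lam) (hC : 1 ≤ C) {β : ℕ → ℝ} {y : ℕ → ℝ} (hrun : IsRun k lam C β x y) (t : ℕ) :
    postVar k lam (fun i : Fin (epochStart k lam C x t) => x i) (x t) ≤
      C ^ 2 * (1 + 1 / lam) * postVar k lam (fun i : Fin t => x i) (x t) := by
  have hx := hrun.repeated t
  have hmem := epochStart_eq_of_mem (k := k) (lam := lam) (C := C) (x := x) t
  have hB := lt_epochStart_add_batchLength (k := k) (lam := lam) (C := C) (x := x) t
  have hle := epochStart_le (k := k) (lam := lam) (C := C) (x := x) t
  generalize epochStart k lam C x t = s at hx hmem hB hle ⊢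
  obtain ⟨b, rfl⟩ := Nat.exists_eq_add_of_le hle
  have hrep := postVar_le_mul_postVar_of_repeated hsymm hpsd hlam x s b fun i hi => by
    rw [hrun.repeated (s + i), hmem (s + i) (by omega) (by omega)]
  rw [hx]
  have hv := postVar_nonneg hsymm hpsd hlam (fun i : Fin s => x i) (x s)
  have hv' := postVar_nonneg hsymm hpsd hlam (fun i : Fin (s + b) => x i) (x s)
  set v := postVar k lam (fun i : Fin s => x i) (x s)
  set v' := postVar k lam (fun i : Fin (s + b) => x i) (x s)
  have hb : (b : ℕ∞) < batchLength C v := by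
    rw [Nat.cast_add] at hB
    exact (ENat.add_lt_add_iff_left (ENat.natCast_ne_top s)).1 hB
  have hbv := mul_le_of_lt_batchLength hC hv hb
  -- The epoch length is not scaled by λ, which is why the factor `1 + 1 / lam` appears.
  have h1 : lam + b * v ≤ C ^ 2 * (lam + 1) := by
    have hC2 : 1 ≤ C ^ 2 := by nlinarith
    nlinarith [mul_le_mul_of_nonneg_right hC2 hlam.le]
  have h2 := hrep.trans (mul_le_mul_of_nonneg_right h1 hv')
  have h3 : C ^ 2 * (1 + 1 / lam) * v' = C ^ 2 * (lam + 1) * v' / lam := by field_simp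
  rw [h3, le_div_iff₀ hlam]
  linarith

end Epochs

/-! ### Exploration coefficients and the regret on the good event. -/

lemma betaBayes_mono {n : ℕ} (hn : 1 ≤ n) {δ : ℝ} (hδ : 0 < δ) {s t : ℕ} (hs : 1 ≤ s)
    (hst : s ≤ t) : betaBayes n δ s ≤ betaBayes n δ t := by
  have hs' : (0 : ℝ) < s := by exact_mod_cast hs
  have hn' : (0 : ℝ) < n := by exact_mod_cast hn
  have hpi := Real.pi_pos
  unfold betaBayes
  gcongr

lemma betaBayes_le {n : ℕ} (hn : 1 ≤ n) {δ : ℝ} (hδ : 0 < δ) (hδ' : δ ≤ 1) {T : ℕ} (hT : 1 ≤ T) :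
    betaBayes n δ T ≤ 2 * (1 + Real.log (n * T / δ)) := by
  have hn' : (1 : ℝ) ≤ n := by exact_mod_cast hn
  have hT' : (1 : ℝ) ≤ T := by exact_mod_cast hT
  have hnT : 1 ≤ (n : ℝ) * T := by nlinarith
  have hL : 0 ≤ Real.log (n * T / δ) := by
    apply Real.log_nonneg
    rw [le_div_iff₀ hδ]
    linarith
  have hpos : 0 < (n : ℝ) * T / δ := by positivity
  -- The factor π²/6 is absorbed into e, which contributes just 1 to the logarithm.
  have hpi : Real.pi ^ 2 / 6 ≤ Real.exp 1 := by
    have := Real.pi_lt_d2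
    have := Real.pi_pos
    have := Real.exp_one_gt_d9
    nlinarith
  have hle : (n : ℝ) * (T : ℝ) ^ 2 * Real.pi ^ 2 / (6 * δ) ≤
      (n * T / δ) * (n * T / δ) * Real.exp 1 := by
    have e : (n : ℝ) * (T : ℝ) ^ 2 * Real.pi ^ 2 / (6 * δ) =
        (n * T / δ) * T * (Real.pi ^ 2 / 6) := by field_simp
    rw [e]
    have hT2 : (T : ℝ) ≤ n * T / δ := by
      rw [le_div_iff₀ hδ]
      nlinarith
    gcongr
  have hlog := Real.log_le_log (by have := Real.pi_pos; positivity) hle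
  rw [Real.log_mul (by positivity) (Real.exp_pos 1).ne', Real.log_mul hpos.ne' hpos.ne',
    Real.log_exp] at hlog
  rw [betaBayes, Real.sqrt_le_left (by positivity)]
  nlinarith

/-- Regret bound on the event that the confidence bounds hold at the beginning of each epoch. -/
lemma regret_le [Fintype A] [Nonempty A] {k : A → A → ℝ} (hsymm : ∀ a b, k a b = k b a)
    (hpsd : ∀ (t : ℕ) (X : Fin t → A), (kernelMatrix k X).PosSemidef) {κ ξ C δ : ℝ}
    (hk : ∀ a, k a a ≤ κ ^ 2) (hξ : 0 < ξ) (hC : 1 ≤ C) (hδ : 0 < δ) (hδ' : δ ≤ 1)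
    {f : A → ℝ} {x : ℕ → A} {y : ℕ → ℝ}
    (hrun : IsRun k (ξ ^ 2) C (betaBayes (Fintype.card A) δ) x y)
    (hconf : ∀ (t : ℕ) (a : A),
      |f a - postMean k (ξ ^ 2) (fun i : Fin t => x i) (fun i : Fin t => y i) a| ≤
        betaBayes (Fintype.card A) δ (t + 1) *
          Real.sqrt (postVar k (ξ ^ 2) (fun i : Fin t => x i) a))
    {T : ℕ} (hT : 1 ≤ T) :
    regret f x T ≤
      4 * Real.sqrt (2 * (1 + 1 / ξ ^ 2) * (ξ ^ 2 + κ ^ 2)) *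
        (1 + Real.log (Fintype.card A * T / δ)) * (C * Real.sqrt (T * maxInfoGain k ξ T)) := by
  have hlam : 0 < ξ ^ 2 := by positivity
  have hn : 1 ≤ Fintype.card A := Fintype.card_pos
  set β := betaBayes (Fintype.card A) δ with hβ
  set v : ℕ → ℝ := fun t => postVar k (ξ ^ 2) (fun i : Fin t => x i) (x t) with hv
  have hv0 : ∀ t, 0 ≤ v t := fun t => postVar_nonneg hsymm hpsd hlam _ _
  have hβ0 : 0 ≤ β T := Real.sqrt_nonneg _
  set c := Real.sqrt (1 + 1 / ξ ^ 2) with hc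
  have hstep : ∀ t ∈ Finset.range T,
      (⨆ a, f a) - f (x t) ≤ 2 * β T * C * c * Real.sqrt (v t) := by
    intro t ht
    have htT := Finset.mem_range.1 ht
    have hE := postVar_epochStart_le hsymm hpsd hlam hC hrun t
    have hxt := hrun.repeated t
    have hle := epochStart_le (k := k) (lam := ξ ^ 2) (C := C) (x := x) t
    have hss := epochStart_eq_of_mem (k := k) (lam := ξ ^ 2) (C := C) (x := x) t _ le_rfl hle
    set s := epochStart k (ξ ^ 2) C x t
    have hsel := hrun.select s hss
    obtain ⟨a, ha⟩ := exists_eq_ciSup_of_finite (f := f)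
    rw [← ha]
    -- Optimism at the epoch start: `f a` is at most its acquisition value, hence at most that of
    -- the chosen candidate, which exceeds its own `f` value by at most two widths.
    have h1 := (abs_le.1 (hconf s a)).2
    have h2 := (abs_le.1 (hconf s (x s))).1
    have h3 := hsel a
    simp only [ucb] at h3
    rw [← hxt] at h2 h3
    have hsq : Real.sqrt (postVar k (ξ ^ 2) (fun i : Fin s => x i) (x t)) ≤
        C * c * Real.sqrt (v t) := by
      refine (Real.sqrt_le_sqrt hE).trans_eq ?_
      rw [Real.sqrt_mul (by positivity), Real.sqrt_mul (by positivity),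
        Real.sqrt_sq (by linarith)]
    have hβs : β (s + 1) ≤ β T := betaBayes_mono hn hδ (by omega) (by omega)
    have h4 := mul_le_mul hβs hsq (Real.sqrt_nonneg _) hβ0
    linarith
  have hsum : ∑ t ∈ Finset.range T, Real.sqrt (v t) ≤
      Real.sqrt (2 * (ξ ^ 2 + κ ^ 2)) * Real.sqrt (T * maxInfoGain k ξ T) := by
    rw [← Real.sqrt_mul (by positivity)]
    apply Real.le_sqrt_of_sq_le
    have h1 := sq_sum_le_card_mul_sum_sq (s := Finset.range T) (f := fun t => Real.sqrt (v t))
    simp only [Finset.card_range, Real.sq_sqrt (hv0 _)] at h1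
    have h2 := mul_le_mul_of_nonneg_left (sum_postVar_le hsymm hpsd hk hξ x T)
      (Nat.cast_nonneg (α := ℝ) T)
    linarith
  have hβT : β T ≤ 2 * (1 + Real.log (Fintype.card A * T / δ)) := betaBayes_le hn hδ hδ' hT
  have hs2 : Real.sqrt (2 * (1 + 1 / ξ ^ 2) * (ξ ^ 2 + κ ^ 2)) =
      c * Real.sqrt (2 * (ξ ^ 2 + κ ^ 2)) := by
    rw [hc, ← Real.sqrt_mul (by positivity)]
    congr 1
    ring
  have hC0 : 0 ≤ C := by linarith
  have hc0 : 0 ≤ c := Real.sqrt_nonneg _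
  calc regret f x T ≤ ∑ t ∈ Finset.range T, 2 * β T * C * c * Real.sqrt (v t) :=
        Finset.sum_le_sum hstep
    _ = 2 * β T * C * c * ∑ t ∈ Finset.range T, Real.sqrt (v t) := by rw [Finset.mul_sum]
    _ ≤ 2 * (2 * (1 + Real.log (Fintype.card A * T / δ))) * C * c *
        (Real.sqrt (2 * (ξ ^ 2 + κ ^ 2)) * Real.sqrt (T * maxInfoGain k ξ T)) := by
      have h0 : 0 ≤ Real.sqrt (2 * (ξ ^ 2 + κ ^ 2)) * Real.sqrt (T * maxInfoGain k ξ T) := by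
        positivity
      have h1 : 0 ≤ 2 * (1 + Real.log (Fintype.card A * T / δ)) := hβ0.trans hβT
      gcongr
    _ = _ := by
      rw [hs2]
      ring

variable {Ω : Type*} [MeasurableSpace Ω]

open scoped ENNReal NNReal

/-! ### Gaussian tails. -/

/-- For nonnegative numbers (s + c)² ≥ s² + c². Integrated over the half-line, this bounds a tail by
an exponential times the mass of that half-line. -/
lemma gaussianPDF_zero_add_le {v : ℝ≥0} {c s : ℝ} (hc : 0 ≤ c) (hs : 0 ≤ s) :
    gaussianPDF 0 v (s + c) ≤ ENNReal.ofReal (Real.exp (-(c ^ 2 / (2 * v)))) * gaussianPDF 0 v s := by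
  rw [gaussianPDF, gaussianPDF, ← ENNReal.ofReal_mul (Real.exp_nonneg _)]
  apply ENNReal.ofReal_le_ofReal
  rw [gaussianPDFReal, gaussianPDFReal, mul_left_comm, ← Real.exp_add]
  gcongr
  rw [← neg_div, ← add_div]
  gcongr
  nlinarith

lemma gaussianReal_Ioi_le {v : ℝ≥0} (hv : v ≠ 0) {c : ℝ} (hc : 0 ≤ c) :
    gaussianReal 0 v (Set.Ioi c) ≤
      ENNReal.ofReal (Real.exp (-(c ^ 2 / (2 * v)))) * gaussianReal 0 v (Set.Ioi 0) := by
  rw [gaussianReal_apply _ hv, gaussianReal_apply _ hv,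
    ← lintegral_const_mul _ (measurable_gaussianPDF 0 v),
    ← (measurePreserving_add_right volume c).setLIntegral_comp_preimage measurableSet_Ioi
      (measurable_gaussianPDF 0 v)]
  simp only [Set.preimage_add_const_Ioi, sub_self]
  exact setLIntegral_mono' measurableSet_Ioi fun s hs => gaussianPDF_zero_add_le hc (le_of_lt hs)

lemma gaussianReal_Iio_neg (v : ℝ≥0) (c : ℝ) :
    gaussianReal 0 v (Set.Iio (-c)) = gaussianReal 0 v (Set.Ioi c) := by
  have h : (gaussianReal 0 v).map (fun x => -x) = gaussianReal 0 v := by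
    rw [gaussianReal_map_neg, neg_zero]
  conv_lhs => rw [← h, Measure.map_apply measurable_neg measurableSet_Iio]
  congr 1
  ext; simp

/-- Two-sided Gaussian tail bound. -/
lemma gaussianReal_abs_gt_le (v : ℝ≥0) {b : ℝ} (hb : 0 ≤ b) :
    gaussianReal 0 v {z | b * Real.sqrt v < |z|} ≤ ENNReal.ofReal (Real.exp (-(b ^ 2 / 2))) := by
  rcases eq_or_ne v 0 with rfl | hv
  · rw [gaussianReal_zero_var, Measure.dirac_apply' _
      (measurableSet_lt measurable_const measurable_abs)]
    simp
  have hvpos : (0 : ℝ) < v := by exact_mod_cast pos_iff_ne_zero.2 hv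
  set c := b * Real.sqrt v with hc
  have hc0 : 0 ≤ c := by positivity
  have hset : {z : ℝ | c < |z|} = Set.Iio (-c) ∪ Set.Ioi c := by
    ext z
    simp only [Set.mem_ofPred_eq, lt_abs, Set.mem_union, Set.mem_Iio, Set.mem_Ioi]
    constructor
    · rintro (h | h)
      · exact Or.inr h
      · exact Or.inl (by linarith)
    · rintro (h | h)
      · exact Or.inr (by linarith)
      · exact Or.inl h
  have he : c ^ 2 / (2 * v) = b ^ 2 / 2 := by
    rw [hc, mul_pow, Real.sq_sqrt hvpos.le]
    field_simp
  -- Keeping the half-line masses makes both tails together cost one exponential instead of two; the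
  -- constant in β_t leaves no room for a factor 2.
  have hone : gaussianReal 0 v (Set.Iio 0) + gaussianReal 0 v (Set.Ioi 0) ≤ 1 := by
    rw [← measure_union (Set.Iio_disjoint_Ici le_rfl |>.mono_right Set.Ioi_subset_Ici_self)
      measurableSet_Ioi]
    exact prob_le_one
  have h1 := gaussianReal_Ioi_le hv hc0
  rw [he] at h1
  have h0 := gaussianReal_Iio_neg v 0
  rw [neg_zero] at h0
  calc gaussianReal 0 v {z | c < |z|}
      ≤ gaussianReal 0 v (Set.Iio (-c)) + gaussianReal 0 v (Set.Ioi c) := by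
        rw [hset]
        exact measure_union_le _ _
    _ ≤ ENNReal.ofReal (Real.exp (-(b ^ 2 / 2))) *
          (gaussianReal 0 v (Set.Iio 0) + gaussianReal 0 v (Set.Ioi 0)) := by
        rw [gaussianReal_Iio_neg, h0, mul_add]
        exact add_le_add h1 h1
    _ ≤ _ := mul_le_of_le_one_right' hone

/-- Because π² > 6 and δ ≤ 1, the logarithm under the square root is nonnegative, so the exponential
inverts it exactly. -/
lemma ofReal_exp_betaBayes {n : ℕ} (hn : 1 ≤ n) {δ : ℝ} (hδ : 0 < δ) (hδ' : δ ≤ 1) (t : ℕ) :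
    n * Real.exp (-(betaBayes n δ (t + 1) ^ 2 / 2)) =
      δ * (6 / Real.pi ^ 2) * (1 / ((t + 1 : ℕ) : ℝ) ^ 2) := by
  have hn' : (1 : ℝ) ≤ n := by exact_mod_cast hn
  have hpi := Real.pi_gt_three
  have ht : (1 : ℝ) ≤ ((t + 1 : ℕ) : ℝ) := by exact_mod_cast Nat.le_add_left 1 t
  set s := ((t + 1 : ℕ) : ℝ)
  have h1 : 1 ≤ (n : ℝ) * s ^ 2 * Real.pi ^ 2 / (6 * δ) := by
    rw [le_div_iff₀ (by positivity)]
    have : 1 ≤ (n : ℝ) * s ^ 2 := by nlinarith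
    nlinarith
  rw [betaBayes, Real.sq_sqrt (by have := Real.log_nonneg h1; positivity),
    mul_div_cancel_left₀ _ two_ne_zero, Real.exp_neg, Real.exp_log (by linarith)]
  field_simp
  rfl

/-! ### Law of the prediction error and confidence bounds under adaptive selection. -/

section Posterior

variable {k : A → A → ℝ} {P : Measure Ω} {f : A → Ω → ℝ} {η : ℕ → Ω → ℝ} {ξ : ℝ}

lemma IsCenteredGP.symm (hf : IsCenteredGP k f P) (a b : A) : k a b = k b a := by
  rw [← hf.cov_eq, ← hf.cov_eq, covariance_comm]

lemma IsCenteredGP.memLp (hf : IsCenteredGP k f P) (a : A) : MemLp (f a) 2 P :=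
  (hf.gaussian.hasGaussianLaw_eval a).memLp_two

lemma IsGaussianNoise.memLp (hη : IsGaussianNoise ξ f η P) (t : ℕ) : MemLp (η t) 2 P :=
  (hη.law t).hasGaussianLaw.memLp_two

lemma IsGaussianNoise.cov_eq (hη : IsGaussianNoise ξ f η P) (s t : ℕ) :
    cov[η s, η t; P] = if s = t then ξ ^ 2 else 0 := by
  split_ifs with h
  · subst h
    rw [covariance_self (hη.law s).aemeasurable, (hη.law s).variance_eq,
      variance_id_gaussianReal, Real.coe_toNNReal _ (sq_nonneg _)]
  · exact (hη.iIndep.indepFun h).covariance_eq_zero (hη.memLp s) (hη.memLp t)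

lemma IsGaussianNoise.cov_left_eq_zero (hf : IsCenteredGP k f P) (hη : IsGaussianNoise ξ f η P)
    (a : A) (t : ℕ) : cov[f a, η t; P] = 0 :=
  (hη.indep.comp (measurable_pi_apply a) (measurable_pi_apply t)).covariance_eq_zero
    (hf.memLp a) (hη.memLp t)

lemma hasGaussianLaw_prior_noise [Fintype A] (hf : IsCenteredGP k f P)
    (hη : IsGaussianNoise ξ f η P) (t : ℕ) :
    HasGaussianLaw (fun ω => (fun a => f a ω, fun i : Fin t => η i ω)) P := by
  refine IndepFun.hasGaussianLaw ?_ ?_ ?_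
  · let L : (↥(Finset.univ : Finset A) → ℝ) →L[ℝ] (A → ℝ) :=
      ContinuousLinearMap.pi fun a => ContinuousLinearMap.proj ⟨a, Finset.mem_univ a⟩
    exact (hf.gaussian.hasGaussianLaw Finset.univ).map L
  · exact iIndepFun.hasGaussianLaw (fun i : Fin t => (hη.law i).hasGaussianLaw)
      (hη.iIndep.precomp Fin.val_injective)
  · exact hη.indep.comp measurable_id
      (measurable_pi_lambda _ fun i : Fin t => measurable_pi_apply (i : ℕ))

/-- The feedback for a fixed sequence of candidates. -/
def feedback (f : A → Ω → ℝ) (η : ℕ → Ω → ℝ) {t : ℕ} (X : Fin t → A) (i : Fin t) (ω : Ω) : ℝ :=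
  f (X i) ω + η i ω

lemma memLp_feedback (hf : IsCenteredGP k f P) (hη : IsGaussianNoise ξ f η P) {t : ℕ}
    (X : Fin t → A) (i : Fin t) : MemLp (feedback f η X i) 2 P :=
  (hf.memLp _).add (hη.memLp _)

/-- The error of the posterior mean for a fixed sequence of candidates. -/
def postError (k : A → A → ℝ) (lam : ℝ) (f : A → Ω → ℝ) (η : ℕ → Ω → ℝ) {t : ℕ} (X : Fin t → A)
    (a : A) (ω : Ω) : ℝ :=
  f a ω - ∑ i, postWeights k lam X a i * feedback f η X i ω

lemma memLp_postError (hf : IsCenteredGP k f P) (hη : IsGaussianNoise ξ f η P) (lam : ℝ) {t : ℕ}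
    (X : Fin t → A) (a : A) : MemLp (postError k lam f η X a) 2 P :=
  (hf.memLp a).sub (memLp_finsetSum _ fun j _ => (memLp_feedback hf hη X j).const_mul _)

/-- Both components are linear in the jointly Gaussian pair of prior values and noise. The error is
written as a family over `Unit` because the covariance criterion for independence concerns two
families. -/
lemma hasGaussianLaw_feedback_postError [Fintype A] (hf : IsCenteredGP k f P)
    (hη : IsGaussianNoise ξ f η P) (lam : ℝ) {t : ℕ} (X : Fin t → A) (a : A) :
    HasGaussianLaw (fun ω => (fun i => feedback f η X i ω,
      fun _ : Unit => postError k lam f η X a ω)) P := by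
  let E := (A → ℝ) × (Fin t → ℝ)
  let F : Fin t → E →L[ℝ] ℝ := fun i =>
    (ContinuousLinearMap.proj (X i)).comp (ContinuousLinearMap.fst ℝ (A → ℝ) (Fin t → ℝ)) +
      (ContinuousLinearMap.proj i).comp (ContinuousLinearMap.snd ℝ (A → ℝ) (Fin t → ℝ))
  let G : E →L[ℝ] ℝ :=
    (ContinuousLinearMap.proj a).comp (ContinuousLinearMap.fst ℝ (A → ℝ) (Fin t → ℝ)) -
      ∑ i, postWeights k lam X a i • F i
  let L : E →L[ℝ] (Fin t → ℝ) × (Unit → ℝ) :=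
    (ContinuousLinearMap.pi F).prod (ContinuousLinearMap.pi fun _ => G)
  have h := (hasGaussianLaw_prior_noise hf hη t).map_fun L
  convert! h using 2 with ω
  refine Prod.ext rfl (funext fun _ => ?_)
  simp [L, G, F, postError, feedback, mul_add]

variable [IsProbabilityMeasure P]

lemma IsCenteredGP.posSemidef (hf : IsCenteredGP k f P) (t : ℕ) (X : Fin t → A) :
    (kernelMatrix k X).PosSemidef := by
  refine Matrix.PosSemidef.of_dotProduct_mulVec_nonneg ?_ fun c => ?_
  · ext i j
    simp [kernelMatrix, hf.symm (X j) (X i)]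
  · have h := variance_nonneg (fun ω => ∑ i, c i * f (X i) ω) P
    rw [← covariance_self (Finset.aemeasurable_fun_sum _ fun i _ =>
        ((hf.memLp (X i)).aestronglyMeasurable.aemeasurable.const_mul _)),
      covariance_fun_sum_fun_sum (fun i => (hf.memLp (X i)).const_mul _)
        (fun i => (hf.memLp (X i)).const_mul _)] at h
    simp only [covariance_const_mul_left, covariance_const_mul_right, hf.cov_eq] at h
    simpa [dotProduct, Matrix.mulVec, kernelMatrix, Finset.mul_sum, mul_comm, mul_left_comm]
      using h

lemma cov_prior_feedback (hf : IsCenteredGP k f P) (hη : IsGaussianNoise ξ f η P) {t : ℕ}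
    (X : Fin t → A) (a : A) (i : Fin t) : cov[f a, feedback f η X i; P] = k a (X i) := by
  change cov[f a, f (X i) + η i; P] = _
  rw [covariance_add_right (hf.memLp _) (hf.memLp _) (hη.memLp _), hf.cov_eq,
    hη.cov_left_eq_zero hf, add_zero]

lemma cov_feedback (hf : IsCenteredGP k f P) (hη : IsGaussianNoise ξ f η P) {t : ℕ}
    (X : Fin t → A) (i j : Fin t) :
    cov[feedback f η X i, feedback f η X j; P] = regMatrix k (ξ ^ 2) X i j := by
  change cov[f (X i) + η i, f (X j) + η j; P] = _
  rw [covariance_add_left (hf.memLp _) (hη.memLp _) ((hf.memLp _).add (hη.memLp _)),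
    covariance_add_right (hf.memLp _) (hf.memLp _) (hη.memLp _),
    covariance_add_right (hη.memLp _) (hf.memLp _) (hη.memLp _),
    hf.cov_eq, hη.cov_left_eq_zero hf, covariance_comm (η i), hη.cov_left_eq_zero hf,
    hη.cov_eq]
  simp [regMatrix, kernelMatrix, Matrix.one_apply, Fin.ext_iff]

/-- These are the normal equations: the weights solve the linear system that makes the error
orthogonal to every observation. -/
lemma cov_feedback_postError (hf : IsCenteredGP k f P) (hη : IsGaussianNoise ξ f η P)
    (hξ : 0 < ξ) {t : ℕ} (X : Fin t → A) (a : A) (i : Fin t) :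
    cov[feedback f η X i, postError k (ξ ^ 2) f η X a; P] = 0 := by
  have hw := congrFun (regMatrix_mulVec_postWeights hf.posSemidef (pow_pos hξ 2) X a) i
  unfold postError
  rw [covariance_fun_sub_right (memLp_feedback hf hη X i) (hf.memLp a)
      (memLp_finsetSum _ fun j _ => (memLp_feedback hf hη X j).const_mul _),
    covariance_fun_sum_right (fun j => (memLp_feedback hf hη X j).const_mul _)
      (memLp_feedback hf hη X i), covariance_comm, cov_prior_feedback hf hη]
  simp only [covariance_const_mul_right, cov_feedback hf hη]
  rw [hf.symm, ← hw]
  simp [Matrix.mulVec, dotProduct, mul_comm]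

/-- By orthogonality to the feedback, only the covariance of the error with `f a` remains. -/
lemma variance_postError (hf : IsCenteredGP k f P) (hη : IsGaussianNoise ξ f η P)
    (hξ : 0 < ξ) {t : ℕ} (X : Fin t → A) (a : A) :
    Var[postError k (ξ ^ 2) f η X a; P] = postVar k (ξ ^ 2) X a := by
  have hm := memLp_postError hf hη (ξ ^ 2) X a
  have hs : MemLp (fun ω => ∑ i, postWeights k (ξ ^ 2) X a i * feedback f η X i ω) 2 P :=
    memLp_finsetSum _ fun j _ => (memLp_feedback hf hη X j).const_mul _
  rw [← covariance_self hm.aestronglyMeasurable.aemeasurable]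
  conv_lhs => enter [1]; unfold postError
  rw [covariance_fun_sub_left (hf.memLp a) hs hm,
    covariance_fun_sum_left (fun j => (memLp_feedback hf hη X j).const_mul _) hm]
  simp only [covariance_const_mul_left, cov_feedback_postError hf hη hξ, mul_zero,
    Finset.sum_const_zero, sub_zero]
  unfold postError
  rw [covariance_fun_sub_right (hf.memLp a) (hf.memLp a) hs,
    covariance_fun_sum_right (fun j => (memLp_feedback hf hη X j).const_mul _) (hf.memLp a),
    hf.cov_eq, postVar_eq_sub]
  simp only [covariance_const_mul_right, cov_prior_feedback hf hη]
  simp only [mul_comm]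

lemma integral_postError (hf : IsCenteredGP k f P) (hη : IsGaussianNoise ξ f η P)
    (lam : ℝ) {t : ℕ} (X : Fin t → A) (a : A) : ∫ ω, postError k lam f η X a ω ∂P = 0 := by
  have hi : ∀ i, Integrable (feedback f η X i) P := fun i =>
    (memLp_feedback hf hη X i).integrable (by norm_num)
  have hηz : ∀ i, ∫ ω, η i ω ∂P = 0 := fun i => by
    rw [(hη.law i).integral_eq, integral_id_gaussianReal]
  have hz : ∀ i, ∫ ω, feedback f η X i ω ∂P = 0 := fun i => by
    unfold feedback
    rw [integral_add ((hf.memLp _).integrable (by norm_num))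
      ((hη.memLp _).integrable (by norm_num)), hf.mean_zero, hηz, add_zero]
  unfold postError
  rw [integral_sub ((hf.memLp _).integrable (by norm_num))
    (integrable_finsetSum _ fun i _ => (hi i).const_mul _), hf.mean_zero,
    integral_finsetSum _ fun i _ => (hi i).const_mul _]
  simp [integral_const_mul, hz]

variable [Fintype A]

/-- For a fixed sequence of candidates, the error of the posterior mean is independent of the
feedback. -/
lemma indepFun_feedback_postError (hf : IsCenteredGP k f P) (hη : IsGaussianNoise ξ f η P)
    (hξ : 0 < ξ) {t : ℕ} (X : Fin t → A) (a : A) :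
    IndepFun (fun ω i => feedback f η X i ω) (postError k (ξ ^ 2) f η X a) P :=
  ((hasGaussianLaw_feedback_postError hf hη (ξ ^ 2) X a).indepFun_of_covariance_eval
    (X := feedback f η X) (Y := fun _ : Unit => postError k (ξ ^ 2) f η X a)
    fun i _ => cov_feedback_postError hf hη hξ X a i).comp measurable_id (measurable_pi_apply ())

lemma measure_postError_gt_le (hf : IsCenteredGP k f P) (hη : IsGaussianNoise ξ f η P)
    (hξ : 0 < ξ) {t : ℕ} (X : Fin t → A) (a : A) {b : ℝ} (hb : 0 ≤ b) :
    P {ω | b * Real.sqrt (postVar k (ξ ^ 2) X a) < |postError k (ξ ^ 2) f η X a ω|} ≤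
      ENNReal.ofReal (Real.exp (-(b ^ 2 / 2))) := by
  have hG : HasGaussianLaw (postError k (ξ ^ 2) f η X a) P :=
    (hasGaussianLaw_feedback_postError hf hη (ξ ^ 2) X a).snd.eval
      (X := fun _ : Unit => postError k (ξ ^ 2) f η X a) ()
  have hmap := hG.map_eq_gaussianReal
  rw [integral_postError hf hη, variance_postError hf hη hξ] at hmap
  have h := gaussianReal_abs_gt_le (postVar k (ξ ^ 2) X a).toNNReal hb
  rw [← hmap, Measure.map_apply_of_aemeasurable hG.aemeasurable
    (measurableSet_lt measurable_const measurable_abs),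
    Real.coe_toNNReal _ (postVar_nonneg hf.symm hf.posSemidef (pow_pos hξ 2) X a)] at h
  exact h

/-- Confidence bound for adaptively chosen candidates. -/
lemma measure_confidence_fail_le (hf : IsCenteredGP k f P) (hη : IsGaussianNoise ξ f η P)
    (hξ : 0 < ξ) {sel : (t : ℕ) → (Fin t → ℝ) → A}
    (hsel : ∀ t a, MeasurableSet (sel t ⁻¹' {a}))
    {x : ℕ → Ω → A} {y : ℕ → Ω → ℝ} (hx : ∀ t ω, x t ω = sel t (fun i => y i ω))
    (hy : ∀ t ω, y t ω = f (x t ω) ω + η t ω) (t : ℕ) (a : A) {b : ℝ} (hb : 0 ≤ b) :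
    P {ω | b * Real.sqrt (postVar k (ξ ^ 2) (fun i : Fin t => x i ω) a) <
        |f a ω - postMean k (ξ ^ 2) (fun i : Fin t => x i ω) (fun i : Fin t => y i ω) a|} ≤
      ENNReal.ofReal (Real.exp (-(b ^ 2 / 2))) := by
  classical
  let S : (Fin t → A) → Set (Fin t → ℝ) := fun X =>
    {u | ∀ i : Fin t, sel i (fun j : Fin i => u ⟨j, j.2.trans i.2⟩) = X i}
  have hS : ∀ X, MeasurableSet (S X) := fun X => by
    simp only [S, Set.ofPred_forall]
    refine MeasurableSet.iInter fun i => ?_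
    have hm : Measurable fun (u : Fin t → ℝ) (j : Fin i) => u ⟨j, j.2.trans i.2⟩ :=
      measurable_pi_lambda _ fun j => measurable_pi_apply _
    exact hm (hsel i (X i))
  -- As long as the rule has followed `X`, the feedback for the fixed sequence is the actual
  -- feedback. Selecting `X` is therefore an event in the feedback for `X` alone.
  have hiff : ∀ X ω, (fun i => feedback f η X i ω) ∈ S X ↔ (fun i : Fin t => x i ω) = X := by
    intro X ω
    constructor
    · intro h
      have key : ∀ n, ∀ hn : n < t, x n ω = X ⟨n, hn⟩ := by
        intro n
        induction n using Nat.strong_induction_on with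
        | _ n ih =>
          intro hn
          rw [hx, ← h ⟨n, hn⟩]
          congr 1
          funext j
          rw [hy, ih j j.2 (j.2.trans hn)]
          rfl
      exact funext fun i => key i i.2
    · rintro rfl i
      simp only [feedback]
      rw [hx]
      congr 1
      funext j
      rw [hy]
  have hmeas : ∀ X : Fin t → A, AEMeasurable (fun ω i => feedback f η X i ω) P := fun X =>
    aemeasurable_pi_lambda _ fun i => (memLp_feedback hf hη X i).aestronglyMeasurable.aemeasurable
  let Ev : (Fin t → A) → Set Ω := fun X => (fun ω i => feedback f η X i ω) ⁻¹' S X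
  let Bad : (Fin t → A) → Set Ω := fun X => postError k (ξ ^ 2) f η X a ⁻¹'
    {z | b * Real.sqrt (postVar k (ξ ^ 2) X a) < |z|}
  have hsub : {ω | b * Real.sqrt (postVar k (ξ ^ 2) (fun i : Fin t => x i ω) a) <
        |f a ω - postMean k (ξ ^ 2) (fun i : Fin t => x i ω) (fun i : Fin t => y i ω) a|} ⊆
      ⋃ X ∈ (Finset.univ : Finset (Fin t → A)), Ev X ∩ Bad X := by
    intro ω hω
    simp only [Set.mem_iUnion, Finset.mem_univ, exists_prop, true_and]
    refine ⟨fun i => x i ω, (hiff _ ω).2 rfl, ?_⟩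
    simp only [Set.mem_ofPred_eq, postMean_eq_sum hf.symm, hy] at hω
    exact hω
  have hdisj : Set.Pairwise (↑(Finset.univ : Finset (Fin t → A)))
      (Function.onFun (AEDisjoint P) Ev) := by
    intro X _ Y _ hXY
    refine Disjoint.aedisjoint (Set.disjoint_left.2 fun ω h1 h2 => hXY ?_)
    exact ((hiff X ω).1 h1).symm.trans ((hiff Y ω).1 h2)
  calc _ ≤ ∑ X : Fin t → A, P (Ev X ∩ Bad X) :=
        (measure_mono hsub).trans (measure_biUnion_finset_le _ _)
    _ = ∑ X : Fin t → A, P (Ev X) * P (Bad X) := Finset.sum_congr rfl fun X _ =>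
        (indepFun_feedback_postError hf hη hξ X a).measure_inter_preimage_eq_mul _ _ (hS X)
          (measurableSet_lt measurable_const measurable_abs)
    _ ≤ ∑ X : Fin t → A, P (Ev X) * ENNReal.ofReal (Real.exp (-(b ^ 2 / 2))) :=
        Finset.sum_le_sum fun X _ => by
          gcongr
          exact measure_postError_gt_le hf hη hξ X a hb
    _ = (∑ X : Fin t → A, P (Ev X)) * ENNReal.ofReal (Real.exp (-(b ^ 2 / 2))) :=
        (Finset.sum_mul _ _ _).symm
    _ ≤ _ := by
        -- The selection events are disjoint, so their masses sum to at most one and no union bound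
        -- over sequences is paid.
        refine mul_le_of_le_one_left' ?_
        exact (sum_measure_le_measure_univ
          (fun X _ => (hmeas X).nullMeasurable (hS X)) hdisj).trans prob_le_one

/-- With probability at least `1 - δ`, all confidence bounds hold simultaneously. -/
lemma le_measure_confidence [Nonempty A] (hf : IsCenteredGP k f P) (hη : IsGaussianNoise ξ f η P)
    (hξ : 0 < ξ) {δ : ℝ} (hδ : 0 < δ) (hδ' : δ ≤ 1) {sel : (t : ℕ) → (Fin t → ℝ) → A}
    (hsel : ∀ t a, MeasurableSet (sel t ⁻¹' {a}))
    {x : ℕ → Ω → A} {y : ℕ → Ω → ℝ} (hx : ∀ t ω, x t ω = sel t (fun i => y i ω))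
    (hy : ∀ t ω, y t ω = f (x t ω) ω + η t ω) :
    ENNReal.ofReal (1 - δ) ≤ P {ω | ∀ (t : ℕ) (a : A),
      |f a ω - postMean k (ξ ^ 2) (fun i : Fin t => x i ω) (fun i : Fin t => y i ω) a| ≤
        betaBayes (Fintype.card A) δ (t + 1) *
          Real.sqrt (postVar k (ξ ^ 2) (fun i : Fin t => x i ω) a)} := by
  set G := {ω | ∀ (t : ℕ) (a : A),
      |f a ω - postMean k (ξ ^ 2) (fun i : Fin t => x i ω) (fun i : Fin t => y i ω) a| ≤
        betaBayes (Fintype.card A) δ (t + 1) *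
          Real.sqrt (postVar k (ξ ^ 2) (fun i : Fin t => x i ω) a)} with hG
  have hn : 1 ≤ Fintype.card A := Fintype.card_pos
  have hsum : HasSum (fun t : ℕ => δ * (6 / Real.pi ^ 2) * (1 / ((t + 1 : ℕ) : ℝ) ^ 2)) δ := by
    -- The dropped term is 1/0² = 0, so the shifted series still sums to π²/6.
    have h := (hasSum_nat_add_iff' 1).2 hasSum_zeta_two
    have h' := h.mul_left (δ * (6 / Real.pi ^ 2))
    convert! h' using 1
    have := Real.pi_pos
    simp
    field_simp
  have hc : P Gᶜ ≤ ENNReal.ofReal δ := by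
    have hsub : Gᶜ ⊆ ⋃ (t : ℕ), ⋃ a ∈ (Finset.univ : Finset A),
        {ω | betaBayes (Fintype.card A) δ (t + 1) *
            Real.sqrt (postVar k (ξ ^ 2) (fun i : Fin t => x i ω) a) <
          |f a ω - postMean k (ξ ^ 2) (fun i : Fin t => x i ω) (fun i : Fin t => y i ω) a|} := by
      intro ω hω
      simpa [hG] using hω
    calc P Gᶜ ≤ ∑' t : ℕ, ∑ _a : A,
          ENNReal.ofReal (Real.exp (-(betaBayes (Fintype.card A) δ (t + 1) ^ 2 / 2))) := by
          refine (measure_mono hsub).trans ((measure_iUnion_le _).trans ?_)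
          refine ENNReal.tsum_le_tsum fun t => (measure_biUnion_finset_le _ _).trans ?_
          exact Finset.sum_le_sum fun a _ =>
            measure_confidence_fail_le hf hη hξ hsel hx hy t a (Real.sqrt_nonneg _)
      _ = ∑' t : ℕ, ENNReal.ofReal (δ * (6 / Real.pi ^ 2) * (1 / ((t + 1 : ℕ) : ℝ) ^ 2)) := by
          refine tsum_congr fun t => ?_
          rw [← ofReal_exp_betaBayes hn hδ hδ', Finset.sum_const, Finset.card_univ, nsmul_eq_mul,
            ENNReal.ofReal_mul (Nat.cast_nonneg _), ENNReal.ofReal_natCast]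
      _ = ENNReal.ofReal δ := by
          rw [← ENNReal.ofReal_tsum_of_nonneg (fun t => by positivity) hsum.summable,
            hsum.tsum_eq]
  -- Subadditivity suffices here, so `G` need not be measurable.
  have h1 : 1 ≤ P G + P Gᶜ := by
    rw [← measure_univ (μ := P), ← Set.union_compl_self G]
    exact measure_union_le _ _
  rw [ENNReal.ofReal_sub _ hδ.le, ENNReal.ofReal_one]
  exact tsub_le_iff_right.2 (h1.trans (add_le_add_right hc _))

end Posterior

end MiniGP

end

theorem mainTheorem4 :
    ∃ p : ℕ, ∀ κ ξ : ℝ, 0 < ξ → ∃ K : ℝ, 0 < K ∧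
      ∀ (A : Type*) [Fintype A] [Nonempty A] (k : A → A → ℝ) (_hk : ∀ a, k a a ≤ κ ^ 2)
        (Ω : Type*) [MeasurableSpace Ω] (P : Measure Ω) [IsProbabilityMeasure P]
        (f : A → Ω → ℝ) (_hf : MiniGP.IsCenteredGP k f P)
        (η : ℕ → Ω → ℝ) (_hη : MiniGP.IsGaussianNoise ξ f η P)
        (C δ : ℝ) (_hC : 1 < C) (_hδ : 0 < δ) (_hδ' : δ ≤ 1)
        (sel : (t : ℕ) → (Fin t → ℝ) → A)
        (_hsel : MiniGP.IsMiniGPUCB k (ξ ^ 2) C (MiniGP.betaBayes (Fintype.card A) δ) sel)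
        (x : ℕ → Ω → A) (y : ℕ → Ω → ℝ)
        (_hx : ∀ t ω, x t ω = sel t (fun i => y i ω))
        (_hy : ∀ t ω, y t ω = f (x t ω) ω + η t ω),
        ENNReal.ofReal (1 - δ) ≤
          P {ω | ∀ T : ℕ, 1 ≤ T →
            MiniGP.regret (fun a => f a ω) (fun t => x t ω) T ≤
              K * (1 + Real.log (Fintype.card A * T / δ)) ^ p *
                (C * Real.sqrt (T * MiniGP.maxInfoGain k ξ T))} := by
  -- One logarithmic power suffices, since β_T ≤ 2 (1 + log(|A| T / δ)). The constant is positive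
  -- even for κ = 0 because ξ > 0.
  refine ⟨1, fun κ ξ hξ =>
    ⟨4 * Real.sqrt (2 * (1 + 1 / ξ ^ 2) * (ξ ^ 2 + κ ^ 2)), by positivity, ?_⟩⟩
  intro A _ _ k hk Ω _ P _ f hf η hη C δ hC hδ hδ' sel hsel x y hx hy
  refine (MiniGP.le_measure_confidence hf hη hξ hδ hδ' hsel.measurable hx hy).trans
    (measure_mono fun ω hω T hT => ?_)
  have hrun := hsel.isRun fun t => y t ω
  simp only [← hx] at hrun
  rw [pow_one]
  exact MiniGP.regret_le hf.symm hf.posSemidef hk hξ hC.le hδ hδ' hrun hω hT
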